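/- Let $n\ge 0$ and let $[n]=\{1,\dots,n\}$ be cyclically ordered, with all indices modulo $n$. A Wilson loop diagram $W=(\mathcal P,[n])$ is given by a set $\mathcal P$ of pairs $p=(i,j)$ with $1\le i<j\le n$, called propagators. The support of $p=(i,j)$ is $V(p)=\{i,i+1,j,j+1\}$, and $V(P)=\bigcup_{p\in P}V(p)$ for $P\subseteq\mathcal P$; for $U\subseteq[n]$ let $\mathrm{Prop}_W(U)=\{p\in\mathcal P: V(p)\cap U\neq\emptyset\}$. The diagram $W$ is weakly admissible if $|V(Q)|\ge|Q|+3$ for every non-empty $Q\subseteq\mathcal P$ and there are no $(i_p,j_p),(i_q,j_q)\in\mathcal P$ with $i_p<i_q<j_p<j_q$. The matroid $M(W)$ has ground set $[n]$, and $I\subseteq[n]$ is independent in it if and only if $|\mathrm{Prop}_W(U)|\ge|U|$ for every $U\subseteq I$; for weakly admissible $W$ it is a positroid. A set $P\subseteq\mathcal P$ defines an exact subdiagram $(P,V(P))$ of $W$ if $|V(P)|=|P|+3$; this exact subdiagram is trivial if $|P|=1$. Say that two weakly admissible diagrams $W=(\mathcal P,[n])$ and $W'=(\mathcal P',[n])$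 differ by an exchange if there are exact subdiagrams $(P,V(P))$ of $W$ and $(P',V(P'))$ of $W'$ with $|P|=|P'|$, $V(P)=V(P')$ and $\mathcal P\setminus P=\mathcal P'\setminus P'$. Let $\sim$ be the reflexive and transitive closure of this relation on the set of weakly admissible Wilson loop diagrams on $[n]$. **Theorem.** 1. For all weakly admissible Wilson loop diagrams $W,W'$ on $[n]$, $M(W)=M(W')$ if and only if $W\sim W'$. 2. In particular, for a weakly admissible Wilson loop diagram $W$ on $[n]$, there is no other weakly admissible diagram on $[n]$ with the same matroid as $W$ if and only if no exchange turns $W$ into a different weakly admissible diagram. 3. If $n\ne4$ and the weakly admissible diagram $W$ on $[n]$ has no non-trivial exact subdiagram, then there is no other weakly admissible diagram on $[n]$ with the same matroid as $W$. -/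

import Mathlib

/-!
Wilson loop diagrams on the cyclically ordered vertex set with `n` elements, whose first vertex
is `0`: vertices are elements of `Fin n`.
-/

/-- A Wilson loop diagram on `n` cyclically ordered vertices: a set of propagators, each an
unordered pair of distinct vertices, written `(i, j)` with `i < j`. The propagator `(i, j)` joins
the edge from `i` to its successor with the edge from `j` to its successor. -/
@[ext]
structure WilsonLoop (n : ℕ) where
  props : Finset (Fin n × Fin n)
  ordered : ∀ p ∈ props, p.1 < p.2

namespace WilsonLoop

variable {n : ℕ}

/-- The successor of a vertex in the cyclic order. -/
def next (i : Fin n) : Fin n := ⟨(i.val + 1) % n, Nat.mod_lt _ i.pos⟩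

/-- The vertex support `{i, i+1, j, j+1}` of a single propagator `(i, j)`. -/
def vert (p : Fin n × Fin n) : Finset (Fin n) := {p.1, next p.1, p.2, next p.2}

/-- The vertex support `V(P)` of a set of propagators. -/
def support (P : Finset (Fin n × Fin n)) : Finset (Fin n) := P.biUnion vert

/-- `Prop(U)`: the propagators of `W` supported at least partially on `U`. -/
def propsOn (W : WilsonLoop n) (U : Finset (Fin n)) : Finset (Fin n × Fin n) :=
  W.props.filter fun p => (vert p ∩ U).Nonempty

/-- Weak admissibility: the density condition and the absence of crossing propagators. -/
structure WeaklyAdmissible (W : WilsonLoop n) : Prop where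
  density : ∀ Q ⊆ W.props, Q.Nonempty → Q.card + 3 ≤ (support Q).card
  noncrossing : ¬ ∃ p ∈ W.props, ∃ q ∈ W.props, p.1 < q.1 ∧ q.1 < p.2 ∧ p.2 < q.2

/-- `P` is the propagator set of an exact subdiagram `(P, V(P))` of `W`. -/
def IsExact (W : WilsonLoop n) (P : Finset (Fin n × Fin n)) : Prop :=
  P ⊆ W.props ∧ (support P).card = P.card + 3

/-- Independence in the matroid of `W`: every subset `U` of `I` satisfies `|U| ≤ |Prop(U)|`. -/
def Indep (W : WilsonLoop n) (I : Finset (Fin n)) : Prop :=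
  ∀ U ⊆ I, U.card ≤ (W.propsOn U).card

theorem propsOn_mono (W : WilsonLoop n) {U U' : Finset (Fin n)} (h : U ⊆ U') :
    W.propsOn U ⊆ W.propsOn U' := by
  intro p hp
  simp only [propsOn, Finset.mem_filter] at hp ⊢
  exact ⟨hp.1, hp.2.mono (Finset.inter_subset_inter_left h)⟩

theorem propsOn_union (W : WilsonLoop n) (U U' : Finset (Fin n)) :
    W.propsOn (U ∪ U') = W.propsOn U ∪ W.propsOn U' := by
  ext p
  simp only [propsOn, Finset.mem_filter, Finset.mem_union, Finset.inter_union_distrib_left,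
    Finset.union_nonempty]
  tauto

/-- In an independent set the subsets `T` with `|Prop(T)| = |T|` are closed under union. -/
theorem tight_union (W : WilsonLoop n) {I S T : Finset (Fin n)} (hI : W.Indep I)
    (hS : S ⊆ I) (hT : T ⊆ I) (hS' : (W.propsOn S).card = S.card)
    (hT' : (W.propsOn T).card = T.card) :
    (W.propsOn (S ∪ T)).card = (S ∪ T).card := by
  have h1 := hI (S ∪ T) (Finset.union_subset hS hT)
  have h2 := hI (S ∩ T) (Finset.inter_subset_left.trans hS)
  have h3 : (W.propsOn (S ∩ T)).card ≤ (W.propsOn S ∩ W.propsOn T).card :=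
    Finset.card_le_card (Finset.subset_inter (W.propsOn_mono Finset.inter_subset_left)
      (W.propsOn_mono Finset.inter_subset_right))
  have h4 := Finset.card_union_add_card_inter S T
  have h5 := Finset.card_union_add_card_inter (W.propsOn S) (W.propsOn T)
  rw [propsOn_union] at h1 ⊢
  omega

theorem indep_empty (W : WilsonLoop n) : W.Indep ∅ := fun U hU => by
  simp [Finset.subset_empty.1 hU]

theorem indep_subset (W : WilsonLoop n) {I J : Finset (Fin n)} (hJ : W.Indep J) (hIJ : I ⊆ J) :
    W.Indep I := fun U hU => hJ U (hU.trans hIJ)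

theorem indep_aug (W : WilsonLoop n) {I J : Finset (Fin n)} (hI : W.Indep I) (hJ : W.Indep J)
    (hIJ : I.card < J.card) : ∃ e ∈ J, e ∉ I ∧ W.Indep (insert e I) := by
  by_contra! hcon
  have key : ∀ A : Finset (Fin n), A ⊆ J \ I → ∃ T ⊆ I, (W.propsOn T).card = T.card ∧
      W.propsOn A ⊆ W.propsOn T := by
    intro A
    induction A using Finset.induction_on with
    | empty => intro _; exact ⟨∅, by simp, by simp [propsOn], by simp [propsOn]⟩
    | insert e A he ih =>
      intro hA
      obtain ⟨T, hT, hT', hAT⟩ := ih ((Finset.subset_insert e A).trans hA)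
      have heJ := Finset.mem_sdiff.1 (hA (Finset.mem_insert_self e A))
      have hn := hcon e heJ.1 heJ.2
      simp only [Indep, not_forall, not_le] at hn
      obtain ⟨U, hU, hUc⟩ := hn
      have heU : e ∈ U := by
        by_contra h
        exact absurd (hI U ((Finset.subset_insert_iff_of_notMem h).1 hU)) (not_le.2 hUc)
      have hSI : U.erase e ⊆ I := Finset.subset_insert_iff.1 hU
      have hm := W.propsOn_mono (Finset.erase_subset e U)
      have h1 := hI _ hSI
      have h2 := Finset.card_le_card hm
      have h3 := Finset.card_erase_add_one heU
      have heq : W.propsOn (U.erase e) = W.propsOn U :=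
        Finset.eq_of_subset_of_card_le hm (by omega)
      have hS' : (W.propsOn (U.erase e)).card = (U.erase e).card := by rw [heq] at h1 ⊢; omega
      refine ⟨U.erase e ∪ T, Finset.union_subset hSI hT, W.tight_union hI hSI hT hS' hT', ?_⟩
      rw [Finset.insert_eq, propsOn_union, propsOn_union, heq]
      exact Finset.union_subset_union (W.propsOn_mono (Finset.singleton_subset_iff.2 heU)) hAT
  obtain ⟨T, hT, hT', hAT⟩ := key (J \ I) subset_rfl
  have h1 := hJ ((J \ I) ∪ (J ∩ T)) (Finset.union_subset Finset.sdiff_subset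
    Finset.inter_subset_left)
  have h2 : W.propsOn ((J \ I) ∪ (J ∩ T)) ⊆ W.propsOn T := by
    rw [propsOn_union]
    exact Finset.union_subset hAT (W.propsOn_mono Finset.inter_subset_right)
  have h3 := Finset.card_le_card h2
  have hd : Disjoint (J \ I) (J ∩ T) := by
    rw [Finset.disjoint_left]
    intro x hx hx'
    exact (Finset.mem_sdiff.1 hx).2 (hT (Finset.mem_inter.1 hx').2)
  rw [Finset.card_union_of_disjoint hd] at h1
  have h4 := Finset.card_sdiff_add_card_inter J I
  have h5 : J ∩ I ⊆ (J ∩ T) ∪ (I \ T) := by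
    intro x hx
    simp only [Finset.mem_inter, Finset.mem_union, Finset.mem_sdiff] at hx ⊢
    tauto
  have h6 := (Finset.card_le_card h5).trans (Finset.card_union_le _ _)
  have h7 := Finset.card_sdiff_add_card_eq_card hT
  omega

/-- The independence structure of `M(W)` on the vertex set. -/
def indepMatroid (W : WilsonLoop n) : IndepMatroid (Fin n) :=
  IndepMatroid.ofFinset (E := Set.univ) (Indep := W.Indep)
    (indep_empty := W.indep_empty)
    (indep_subset := fun _ _ hJ hIJ => W.indep_subset hJ hIJ)
    (indep_aug := fun _ _ hI hJ h => W.indep_aug hI hJ h)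
    (subset_ground := fun _ _ => Set.subset_univ _)

/-- The matroid `M(W)` with ground set the vertex set. -/
def matroid (W : WilsonLoop n) : Matroid (Fin n) := W.indepMatroid.matroid

theorem matroid_ground (W : WilsonLoop n) : W.matroid.E = Set.univ := rfl

theorem matroid_indep_iff (W : WilsonLoop n) (I : Finset (Fin n)) :
    W.matroid.Indep (I : Set (Fin n)) ↔ ∀ U ⊆ I, U.card ≤ (W.propsOn U).card := by
  rw [matroid, IndepMatroid.matroid_Indep, indepMatroid, IndepMatroid.ofFinset_indep]
  exact Iff.rfl

end WilsonLoop

/-- Weakly admissible Wilson loop diagrams on `n` cyclically ordered vertices. -/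
abbrev WeakWilsonLoop (n : ℕ) := {W : WilsonLoop n // W.WeaklyAdmissible}

namespace WeakWilsonLoop

variable {n : ℕ}

/-- `W` and `W'` differ by the exchange of exact subdiagrams with the same vertex support and the
same number of propagators; all other propagators agree. -/
def Exchange (W W' : WeakWilsonLoop n) : Prop :=
  ∃ P P' : Finset (Fin n × Fin n), W.1.IsExact P ∧ W'.1.IsExact P' ∧ P.card = P'.card ∧
    WilsonLoop.support P = WilsonLoop.support P' ∧ W.1.props \ P = W'.1.props \ P'

/-- Equivalence: finitely many (possibly no) exchanges through weakly admissible diagrams. For a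
diagram with at least one propagator this is the transitive closure of `Exchange`, which is
symmetric and relates such a diagram to itself; allowing no exchange makes the relation reflexive
also at the diagram without propagators. -/
def Equivalent (W W' : WeakWilsonLoop n) : Prop := Relation.ReflTransGen Exchange W W'

/-- `W` has an exact subdiagram that does not consist of a single propagator. -/
def HasNontrivialExact (W : WeakWilsonLoop n) : Prop :=
  ∃ P : Finset (Fin n × Fin n), W.1.IsExact P ∧ P.card ≠ 1

end WeakWilsonLoop

/-! By Hall's theorem, independent sets are the vertex sets that can be matched into propagators,
and density makes the rank of M(W) equal to the number of propagators.

Exactness is visible in the matroid. If P is exact in W, independent sets avoiding V(P) have at most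
|W| - |P| elements. If W' has the same matroid, Hall's theorem with deficiency gives Q in W' with
|V(Q) \ V(P)| + |P| ≤ |Q|. Since |V(P)| = |P| + 3, density of Q forces Q exact and V(P) ⊆ V(Q)
(`IsExact.exists_support_subset`). Going back to W from a maximal P gives exact subdiagrams with a
common support (`exists_common_exact`). Swapping them keeps weak admissibility
(`swap_weaklyAdmissible`) and brings W closer to W'.

Conversely, an exchange preserves independence (`Indep.of_exchange`): by density, any |P'| vertices
of V(P') can be matched into P'. The last two claims follow, since a class in which no exchange
moves W is a singleton. -/

/-- Hall's marriage theorem with deficiency `d`, with the matched elements as the outcome. -/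
theorem exists_matched_of_card_le_card_biUnion_add {ι α : Type*} [DecidableEq α]
    (F : Finset ι) (t : ι → Finset α) (d : ℕ)
    (h : ∀ Q ⊆ F, Q.card ≤ (Q.biUnion t).card + d) :
    ∃ T ⊆ F.biUnion t, F.card ≤ T.card + d ∧
      ∀ U ⊆ T, U.card ≤ (F.filter fun i => (t i ∩ U).Nonempty).card := by
  classical
  -- Adding `d` dummy elements to every set restores Hall's condition; discarding them afterwards
  -- loses at most `d` matches.
  obtain ⟨g, hg, hgt⟩ := (Finset.all_card_le_biUnion_card_iff_exists_injective
      fun i : F => (t i).disjSum (Finset.univ : Finset (Fin d))).1 (by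
    intro s
    rcases s.eq_empty_or_nonempty with rfl | ⟨i₀, hi₀⟩
    · simp
    have h1 := h (s.map (Function.Embedding.subtype _)) (by
      intro x hx
      obtain ⟨y, -, rfl⟩ := Finset.mem_map.1 hx
      exact y.2)
    have h2 : ((s.map (Function.Embedding.subtype _)).biUnion t).disjSum
        (Finset.univ : Finset (Fin d)) ⊆
        s.biUnion fun i : F => (t i).disjSum (Finset.univ : Finset (Fin d)) := by
      intro x hx
      rcases x with x | x
      · simp only [Finset.inl_mem_disjSum, Finset.mem_biUnion, Finset.mem_map] at hx
        obtain ⟨_, ⟨a, ha, rfl⟩, hx⟩ := hx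
        exact Finset.mem_biUnion.2 ⟨a, ha, Finset.inl_mem_disjSum.2 hx⟩
      · exact Finset.mem_biUnion.2 ⟨i₀, hi₀, Finset.inr_mem_disjSum.2 (Finset.mem_univ x)⟩
    have h3 := Finset.card_le_card h2
    rw [Finset.card_disjSum, Finset.card_univ, Fintype.card_fin] at h3
    rw [Finset.card_map] at h1
    omega)
  have hT : ∀ a ∈ (Finset.univ.image g).toLeft, ∃ i : F, a ∈ t i ∧ g i = Sum.inl a := by
    intro a ha
    rw [Finset.mem_toLeft] at ha
    obtain ⟨i, -, hi⟩ := Finset.mem_image.1 ha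
    have hit := hgt i
    rw [hi] at hit
    exact ⟨i, Finset.inl_mem_disjSum.1 hit, hi⟩
  refine ⟨(Finset.univ.image g).toLeft, ?_, ?_, ?_⟩
  · intro a ha
    obtain ⟨i, hi, -⟩ := hT a ha
    exact Finset.mem_biUnion.2 ⟨i, i.2, hi⟩
  · have h1 := Finset.card_toLeft_add_card_toRight (u := Finset.univ.image g)
    have h2 := Finset.card_le_univ (Finset.univ.image g).toRight
    rw [Finset.card_image_of_injective _ hg, Finset.card_univ, Fintype.card_coe] at h1
    rw [Fintype.card_fin] at h2
    omega
  · intro U hU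
    have h1 : U.map Function.Embedding.inl ⊆
        (Finset.univ.filter fun i : F => (t i ∩ U).Nonempty).image g := by
      intro x hx
      obtain ⟨a, ha, rfl⟩ := Finset.mem_map.1 hx
      obtain ⟨i, hi, hgi⟩ := hT a (hU ha)
      exact Finset.mem_image.2
        ⟨i, Finset.mem_filter.2 ⟨Finset.mem_univ _, a, Finset.mem_inter.2 ⟨hi, ha⟩⟩, hgi⟩
    have h2 : ((Finset.univ.filter fun i : F => (t i ∩ U).Nonempty).map
        (Function.Embedding.subtype _)) ⊆ F.filter fun i => (t i ∩ U).Nonempty := by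
      intro x hx
      obtain ⟨y, hy, rfl⟩ := Finset.mem_map.1 hx
      exact Finset.mem_filter.2 ⟨y.2, (Finset.mem_filter.1 hy).2⟩
    have h3 := (Finset.card_le_card h1).trans Finset.card_image_le
    have h4 := Finset.card_le_card h2
    rw [Finset.card_map] at h3 h4
    exact h3.trans h4

/-! ### Supports, matchings and rank -/

namespace WilsonLoop

variable {n : ℕ}

theorem next_cases (i : Fin n) : i.val + 1 < n ∧ (next i).val = i.val + 1 ∨
    i.val + 1 = n ∧ (next i).val = 0 := by
  rcases Nat.lt_or_ge (i.val + 1) n with h | h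
  · exact Or.inl ⟨h, Nat.mod_eq_of_lt h⟩
  · have h' : i.val + 1 = n := by omega
    exact Or.inr ⟨h', by simp [next, h']⟩

theorem mem_vert {p : Fin n × Fin n} {v : Fin n} :
    v ∈ vert p ↔ v = p.1 ∨ v = next p.1 ∨ v = p.2 ∨ v = next p.2 := by
  simp [vert]

theorem mem_support {P : Finset (Fin n × Fin n)} {v : Fin n} :
    v ∈ support P ↔ ∃ p ∈ P, v ∈ vert p := by
  simp [support]

theorem vert_subset_support {P : Finset (Fin n × Fin n)} {p : Fin n × Fin n} (hp : p ∈ P) :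
    vert p ⊆ support P := fun _ hv => mem_support.2 ⟨p, hp, hv⟩

theorem support_mono {P Q : Finset (Fin n × Fin n)} (h : P ⊆ Q) : support P ⊆ support Q :=
  Finset.biUnion_subset_biUnion_of_subset_left _ h

theorem support_union (P Q : Finset (Fin n × Fin n)) :
    support (P ∪ Q) = support P ∪ support Q := Finset.union_biUnion

theorem matroid_eq_iff (W W' : WilsonLoop n) :
    W.matroid = W'.matroid ↔ ∀ I : Finset (Fin n), W.Indep I ↔ W'.Indep I := by
  constructor
  · intro h I
    have h1 := W.matroid_indep_iff I
    rw [h, W'.matroid_indep_iff] at h1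
    exact h1.symm
  · intro h
    refine Matroid.ext_indep rfl fun I _ => ?_
    obtain ⟨J, rfl⟩ := I.toFinite.exists_finset_coe
    rw [matroid_indep_iff, matroid_indep_iff]
    exact h J

theorem Indep.card_le {W : WilsonLoop n} {I : Finset (Fin n)} (h : W.Indep I) :
    I.card ≤ W.props.card :=
  (h I subset_rfl).trans (Finset.card_le_card (Finset.filter_subset _ _))

/-- An independent set can be matched into the propagators. -/
theorem Indep.exists_matching {W : WilsonLoop n} {I : Finset (Fin n)} (h : W.Indep I) :
    ∃ f : I → Fin n × Fin n, Function.Injective f ∧ ∀ x : I, f x ∈ W.props ∧ x.1 ∈ vert (f x) := by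
  obtain ⟨f, hf, hft⟩ := (Finset.all_card_le_biUnion_card_iff_exists_injective
      fun x : I => W.props.filter fun p => x.1 ∈ vert p).1 (by
    intro s
    have h1 := h (s.map (Function.Embedding.subtype _)) (by
      intro x hx
      obtain ⟨y, -, rfl⟩ := Finset.mem_map.1 hx
      exact y.2)
    rw [Finset.card_map] at h1
    refine h1.trans (Finset.card_le_card ?_)
    intro p hp
    obtain ⟨hp, v, hv⟩ := Finset.mem_filter.1 hp
    obtain ⟨hv, hvs⟩ := Finset.mem_inter.1 hv
    obtain ⟨y, hy, rfl⟩ := Finset.mem_map.1 hvs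
    exact Finset.mem_biUnion.2 ⟨y, hy, Finset.mem_filter.2 ⟨hp, hv⟩⟩)
  exact ⟨f, hf, fun x => Finset.mem_filter.1 (hft x)⟩

/-- If every set of propagators of `W` has at least as many supporting vertices outside `V` as it
has elements, up to the deficiency `d`, then there is an independent set of size at least
`|W| - d` disjoint from `V`. -/
theorem exists_indep_disjoint (W : WilsonLoop n) (V : Finset (Fin n)) (d : ℕ)
    (h : ∀ Q ⊆ W.props, Q.card ≤ (support Q \ V).card + d) :
    ∃ I, Disjoint I V ∧ W.props.card ≤ I.card + d ∧ W.Indep I := by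
  obtain ⟨T, hT, hc, hU⟩ := exists_matched_of_card_le_card_biUnion_add W.props
    (fun p => vert p \ V) d (by
      intro Q hQ
      convert h Q hQ using 3
      ext v
      simp only [Finset.mem_biUnion, Finset.mem_sdiff, mem_support]
      tauto)
  refine ⟨T, ?_, hc, ?_⟩
  · rw [Finset.disjoint_left]
    intro v hv
    obtain ⟨p, -, hp⟩ := Finset.mem_biUnion.1 (hT hv)
    exact (Finset.mem_sdiff.1 hp).2
  · intro U hUT
    refine (hU U hUT).trans (Finset.card_le_card ?_)
    intro p hp
    obtain ⟨hp, v, hv⟩ := Finset.mem_filter.1 hp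
    obtain ⟨hv, hvU⟩ := Finset.mem_inter.1 hv
    exact Finset.mem_filter.2 ⟨hp, v, Finset.mem_inter.2 ⟨(Finset.mem_sdiff.1 hv).1, hvU⟩⟩

/-- Density gives Hall's condition without deficiency, so all propagators of `W` are matched at once
by an independent set. -/
theorem WeaklyAdmissible.card_le_of_indep_imp {W W' : WilsonLoop n} (hW : W.WeaklyAdmissible)
    (h : ∀ I, W.Indep I → W'.Indep I) : W.props.card ≤ W'.props.card := by
  obtain ⟨I, -, hI, hind⟩ := W.exists_indep_disjoint ∅ 0 (by
    intro Q hQ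
    rcases Q.eq_empty_or_nonempty with rfl | hne
    · simp
    have := hW.density Q hQ hne
    rw [Finset.sdiff_empty]
    omega)
  exact hI.trans (h I hind).card_le

/-! ### Exact subdiagrams and the matroid -/

theorem IsExact.nonempty {W : WilsonLoop n} {P : Finset (Fin n × Fin n)} (h : W.IsExact P) :
    P.Nonempty := by
  by_contra hne
  rw [Finset.not_nonempty_iff_eq_empty] at hne
  subst hne
  have := h.2
  simp [support] at this

/-- An exact subdiagram contains all propagators supported on its vertices. -/
theorem IsExact.mem_of_vert_subset {W : WilsonLoop n} (hW : W.WeaklyAdmissible)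
    {P : Finset (Fin n × Fin n)} (hP : W.IsExact P) {q : Fin n × Fin n} (hq : q ∈ W.props)
    (hqP : vert q ⊆ support P) : q ∈ P := by
  by_contra hqn
  -- Adding `q` would raise the count without enlarging a support that density already makes as
  -- small as possible.
  have h1 := hW.density (insert q P) (Finset.insert_subset hq hP.1) (Finset.insert_nonempty _ _)
  have h2 : support (insert q P) = support P := by
    rw [Finset.insert_eq, support_union, Finset.union_eq_right]
    simpa [support] using hqP
  rw [h2, hP.2, Finset.card_insert_of_notMem hqn] at h1
  omega

/-- The support of an exact subdiagram is contained in the support of an exact subdiagram of any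
weakly admissible diagram with the same independent sets. -/
theorem IsExact.exists_support_subset {W W' : WilsonLoop n} (hW : W.WeaklyAdmissible)
    (hW' : W'.WeaklyAdmissible) (h : ∀ I, W.Indep I ↔ W'.Indep I)
    {P : Finset (Fin n × Fin n)} (hP : W.IsExact P) :
    ∃ Q, W'.IsExact Q ∧ support P ⊆ support Q := by
  have hpos := hP.nonempty.card_pos
  have hcard := hW.card_le_of_indep_imp fun I => (h I).1
  have hle : ∀ I : Finset (Fin n), Disjoint I (support P) → W.Indep I →
      I.card + P.card ≤ W.props.card := by
    intro I hI hind
    have h1 : W.propsOn I ⊆ W.props \ P := by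
      intro p hp
      obtain ⟨hp, v, hv⟩ := Finset.mem_filter.1 hp
      obtain ⟨hv, hvI⟩ := Finset.mem_inter.1 hv
      exact Finset.mem_sdiff.2 ⟨hp, fun hpP =>
        Finset.disjoint_left.1 hI hvI (vert_subset_support hpP hv)⟩
    have h2 := (hind I subset_rfl).trans (Finset.card_le_card h1)
    have h3 := Finset.card_sdiff_add_card_eq_card hP.1
    omega
  -- Otherwise deficiency |P| - 1 suffices, giving an independent set one element larger than `hle`
  -- allows.
  have hQ : ∃ Q ⊆ W'.props, (support Q \ support P).card + (P.card - 1) < Q.card := by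
    by_contra! hcon
    obtain ⟨I, hI, hIc, hind⟩ := W'.exists_indep_disjoint (support P) (P.card - 1) hcon
    have := hle I hI ((h I).2 hind)
    omega
  obtain ⟨Q, hQ, hQc⟩ := hQ
  have h1 := hW'.density Q hQ (Finset.card_pos.1 (by omega))
  have h2 := Finset.card_sdiff_add_card_inter (support Q) (support P)
  have h3 : (support Q ∩ support P).card ≤ (support P).card :=
    Finset.card_le_card Finset.inter_subset_right
  have h4 := hP.2
  refine ⟨Q, ⟨hQ, by omega⟩, ?_⟩
  have h5 : support Q ∩ support P = support P :=
    Finset.eq_of_subset_of_card_le Finset.inter_subset_right (by omega)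
  exact Finset.inter_eq_right.1 h5

/-- Each propagator lies in an exact subdiagram whose support is also the support of an exact
subdiagram of a given weakly admissible diagram with the same independent sets. -/
theorem exists_common_exact {W W' : WilsonLoop n} (hW : W.WeaklyAdmissible)
    (hW' : W'.WeaklyAdmissible) (h : ∀ I, W.Indep I ↔ W'.Indep I)
    {p : Fin n × Fin n} (hp : p ∈ W.props) :
    ∃ P P', W.IsExact P ∧ W'.IsExact P' ∧ support P = support P' ∧ p ∈ P := by
  classical
  -- A single propagator is exact: density gives at least four vertices, and it has at most four.
  have hex : ∃ P ∈ W.props.powerset, W.IsExact P ∧ p ∈ P := by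
    refine ⟨{p}, by simpa using hp, ⟨by simpa using hp, ?_⟩, by simp⟩
    refine le_antisymm ?_ (hW.density {p} (by simpa using hp) (by simp))
    simpa [support, vert] using Finset.card_le_four
  obtain ⟨P, hP, hmax⟩ := (W.props.powerset.filter fun P => W.IsExact P ∧ p ∈ P).exists_max_image
    (fun P => (support P).card) (by
      obtain ⟨P, h1, h2⟩ := hex
      exact ⟨P, Finset.mem_filter.2 ⟨h1, h2⟩⟩)
  obtain ⟨-, hP, hpP⟩ := Finset.mem_filter.1 hP
  obtain ⟨P', hP', hsub⟩ := hP.exists_support_subset hW hW' h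
  obtain ⟨Q, hQ, hsub'⟩ := hP'.exists_support_subset hW' hW fun I => (h I).symm
  have hpQ : p ∈ Q := hQ.mem_of_vert_subset hW hp
    ((vert_subset_support hpP).trans (hsub.trans hsub'))
  have h1 := hmax Q (Finset.mem_filter.2 ⟨Finset.mem_powerset.2 hQ.1, hQ, hpQ⟩)
  have h2 := Finset.card_le_card hsub'
  exact ⟨P, P', hP, hP', Finset.eq_of_subset_of_card_le hsub (by omega), hpP⟩

/-- Replacing an exact subdiagram by another one with the same support keeps independent sets
independent. -/
theorem Indep.of_exchange {W W' : WilsonLoop n} (hW' : W'.WeaklyAdmissible)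
    {P P' : Finset (Fin n × Fin n)} (hP' : W'.IsExact P')
    (hcard : P.card = P'.card) (hsupp : support P = support P')
    (hrest : W.props \ P = W'.props \ P') {I : Finset (Fin n)} (hI : W.Indep I) :
    W'.Indep I := by
  classical
  obtain ⟨f, hf, hfI⟩ := hI.exists_matching
  intro U hU
  let A : Finset I := Finset.univ.filter fun x => x.1 ∈ U ∧ f x ∈ P
  let B : Finset I := Finset.univ.filter fun x => x.1 ∈ U ∧ f x ∉ P
  have hUAB : U.card ≤ A.card + B.card := by
    have h1 : U ⊆ (A ∪ B).map (Function.Embedding.subtype _) := by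
      intro x hx
      refine Finset.mem_map.2 ⟨⟨x, hU hx⟩, ?_, rfl⟩
      simp only [A, B, Finset.mem_union, Finset.mem_filter, Finset.mem_univ, true_and, hx]
      tauto
    have h2 := Finset.card_le_card h1
    rw [Finset.card_map] at h2
    exact h2.trans (Finset.card_union_le _ _)
  have hA : A.card ≤ (P'.filter fun p => (vert p ∩ U).Nonempty).card := by
    have hAP : A.card ≤ P'.card := by
      rw [← hcard]
      exact Finset.card_le_card_of_injOn f (fun x hx => (Finset.mem_filter.1 hx).2.2) hf.injOn
    -- Let R be the part of `P'` missing `U`. If R is non-empty, V(R) has at least |R| + 3 vertices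
    -- and is disjoint from `A` inside V(P'), of size |P'| + 3, so |A| ≤ |P'| - |R|.
    have h1 := Finset.card_filter_add_card_filter_not (s := P') fun p => (vert p ∩ U).Nonempty
    rcases (P'.filter fun p => ¬ (vert p ∩ U).Nonempty).eq_empty_or_nonempty with h0 | hne
    · rw [h0, Finset.card_empty] at h1
      omega
    have h2 := hW'.density _ ((Finset.filter_subset _ _).trans hP'.1) hne
    have h3 : Disjoint (support (P'.filter fun p => ¬ (vert p ∩ U).Nonempty))
        (A.map (Function.Embedding.subtype _)) := by
      rw [Finset.disjoint_left]
      intro v hv hvA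
      obtain ⟨p, hp, hvp⟩ := mem_support.1 hv
      obtain ⟨x, hx, rfl⟩ := Finset.mem_map.1 hvA
      exact (Finset.mem_filter.1 hp).2
        ⟨_, Finset.mem_inter.2 ⟨hvp, (Finset.mem_filter.1 hx).2.1⟩⟩
    have h4 : support (P'.filter fun p => ¬ (vert p ∩ U).Nonempty) ∪
        A.map (Function.Embedding.subtype _) ⊆ support P' := by
      refine Finset.union_subset (support_mono (Finset.filter_subset _ _)) ?_
      intro v hv
      obtain ⟨x, hx, rfl⟩ := Finset.mem_map.1 hv
      rw [← hsupp]
      exact vert_subset_support (Finset.mem_filter.1 hx).2.2 (hfI x).2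
    have h5 := Finset.card_le_card h4
    rw [Finset.card_union_of_disjoint h3, Finset.card_map, hP'.2] at h5
    omega
  have hB : B.card ≤ ((W'.props \ P').filter fun p => (vert p ∩ U).Nonempty).card := by
    refine Finset.card_le_card_of_injOn f (fun x hx => ?_) hf.injOn
    obtain ⟨-, hxU, hxP⟩ := Finset.mem_filter.1 hx
    refine Finset.mem_filter.2 ⟨?_, x.1, Finset.mem_inter.2 ⟨(hfI x).2, hxU⟩⟩
    rw [← hrest]
    exact Finset.mem_sdiff.2 ⟨(hfI x).1, hxP⟩
  have h1 : W'.propsOn U = (P'.filter fun p => (vert p ∩ U).Nonempty) ∪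
      ((W'.props \ P').filter fun p => (vert p ∩ U).Nonempty) := by
    rw [← Finset.filter_union, Finset.union_sdiff_of_subset hP'.1]
    rfl
  rw [h1, Finset.card_union_of_disjoint
    (Finset.disjoint_filter_filter Finset.disjoint_sdiff)]
  omega

/-! ### Swapping exact subdiagrams -/

/-- Two propagators cross, for the first one starting first. -/
def Crosses (p q : Fin n × Fin n) : Prop := p.1 < q.1 ∧ q.1 < p.2 ∧ p.2 < q.2

/-- A chord that crosses no propagator of an exact subdiagram and is not supported on its vertices
crosses no chord supported on its vertices. -/
theorem IsExact.not_crosses {W : WilsonLoop n} (hW : W.WeaklyAdmissible)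
    {P : Finset (Fin n × Fin n)} (hP : W.IsExact P) {p q : Fin n × Fin n} (hq : q.1 < q.2)
    (hcross : ∀ r ∈ P, ¬ Crosses r q ∧ ¬ Crosses q r) (hqP : ¬ vert q ⊆ support P)
    (hpP : vert p ⊆ support P) : ¬ Crosses p q ∧ ¬ Crosses q p := by
  classical
  obtain ⟨c, d⟩ := q
  simp only [Crosses] at hq hcross ⊢
  have hord : ∀ r ∈ P, r.1 < r.2 := fun r hr => W.ordered r (hP.1 hr)
  -- If both edges at which `q` ends were used by `P`, then `q` would be supported on V(P).
  have hend : (∀ r ∈ P, r.1 ≠ c ∧ r.2 ≠ c) ∨ (∀ r ∈ P, r.1 ≠ d ∧ r.2 ≠ d) := by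
    by_contra! hcon
    obtain ⟨⟨r, hr, hrc⟩, ⟨s, hs, hsd⟩⟩ := hcon
    have hsub : ∀ r ∈ P, ∀ e, (r.1 ≠ e → r.2 = e) → e ∈ support P ∧ next e ∈ support P := by
      intro r hr e he
      by_cases h : r.1 = e
      · exact ⟨mem_support.2 ⟨r, hr, by simp [mem_vert, h]⟩,
          mem_support.2 ⟨r, hr, by simp [mem_vert, h]⟩⟩
      · exact ⟨mem_support.2 ⟨r, hr, by simp [mem_vert, he h]⟩,
          mem_support.2 ⟨r, hr, by simp [mem_vert, he h]⟩⟩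
    have h1 := hsub r hr c hrc
    have h2 := hsub s hs d hsd
    refine hqP fun v hv => ?_
    rcases mem_vert.1 hv with rfl | rfl | rfl | rfl
    exacts [h1.1, h1.2, h2.1, h2.2]
  -- The chord `q` separates `P` into the propagators inside it and those outside it.
  let A := P.filter fun r => c ≤ r.1 ∧ r.2 ≤ d
  let B := P.filter fun r => ¬ (c ≤ r.1 ∧ r.2 ≤ d)
  have hAB : P = A ∪ B := (Finset.filter_union_filter_not_eq _ P).symm
  have hA : ∀ r ∈ A, c.val ≤ r.1.val ∧ r.1.val < r.2.val ∧ r.2.val ≤ d.val := fun r hr =>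
    ⟨(Finset.mem_filter.1 hr).2.1, hord r (Finset.mem_filter.1 hr).1,
      (Finset.mem_filter.1 hr).2.2⟩
  have hB : ∀ r ∈ B, r.1.val < r.2.val ∧ (r.1.val ≤ c.val ∨ d.val ≤ r.1.val) ∧
      (r.2.val ≤ c.val ∨ d.val ≤ r.2.val) := by
    intro r hr
    obtain ⟨hr, hrB⟩ := Finset.mem_filter.1 hr
    have h1 := hord r hr
    have h2 := hcross r hr
    simp only [Fin.lt_def, Fin.le_def] at h1 h2 hrB hq
    omega
  have hp : ∀ v ∈ vert p, v ∈ support A ∪ support B := by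
    intro v hv
    rw [← support_union, ← hAB]
    exact hpP hv
  have hp1 := hp p.1 (by simp [mem_vert])
  have hp2 := hp (next p.1) (by simp [mem_vert])
  have hp3 := hp p.2 (by simp [mem_vert])
  have hp4 := hp (next p.2) (by simp [mem_vert])
  -- Two non-empty sides sharing at most two vertices would have at least |A| + 3 + |B| + 3 - 2 =
  -- |P| + 4 vertices, too many for an exact `P`. Only the edge at the end of `q` that `P` may use
  -- can be shared, so `P` lies on one side, and then so does `p`.
  have hone : (support A ∩ support B).card ≤ 2 → support A = ∅ ∨ support B = ∅ := by
    intro h5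
    rcases A.eq_empty_or_nonempty with h | hA
    · exact Or.inl (by rw [h]; rfl)
    rcases B.eq_empty_or_nonempty with h | hB
    · exact Or.inr (by rw [h]; rfl)
    have h1 := hW.density A ((Finset.filter_subset _ _).trans hP.1) hA
    have h2 := hW.density B ((Finset.filter_subset _ _).trans hP.1) hB
    have h3 : A.card + B.card = P.card := Finset.card_filter_add_card_filter_not _
    have h4 := Finset.card_union_add_card_inter (support A) (support B)
    rw [← support_union, ← hAB, hP.2] at h4
    omega
  have hnp1 := next_cases p.1
  have hnp2 := next_cases p.2
  have hnc := next_cases c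
  have hnd := next_cases d
  have hd := d.isLt
  have hpl1 := p.1.isLt
  have hpl2 := p.2.isLt
  simp only [Fin.lt_def] at hq ⊢
  rcases hend with hend | hend
  · have hvA : ∀ v ∈ support A, (c.val < v.val ∧ v.val ≤ d.val) ∨ v.val = (next d).val := by
      intro v hv
      obtain ⟨r, hr, hv⟩ := mem_support.1 hv
      have h1 := hA r hr
      have h2 := hend r (Finset.mem_filter.1 hr).1
      have h3 := next_cases r.1
      have h4 := next_cases r.2
      simp only [ne_eq, Fin.ext_iff, mem_vert] at h2 hv
      omega
    have hvB : ∀ v ∈ support B, v.val ≤ c.val ∨ d.val ≤ v.val := by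
      intro v hv
      obtain ⟨r, hr, hv⟩ := mem_support.1 hv
      have h1 := hB r hr
      have h2 := hend r (Finset.mem_filter.1 hr).1
      have h3 := next_cases r.1
      have h4 := next_cases r.2
      simp only [ne_eq, Fin.ext_iff, mem_vert] at h2 hv
      omega
    have hinter : (support A ∩ support B).card ≤ 2 := by
      refine (Finset.card_le_card (t := {d, next d}) fun v hv => ?_).trans Finset.card_le_two
      have h1 := hvA v (Finset.mem_inter.1 hv).1
      have h2 := hvB v (Finset.mem_inter.1 hv).2
      simp only [Finset.mem_insert, Finset.mem_singleton, Fin.ext_iff]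
      omega
    rcases hone hinter with h | h
    · rw [h, Finset.empty_union] at hp1 hp3
      have h1 := hvB _ hp1
      have h3 := hvB _ hp3
      omega
    · rw [h, Finset.union_empty] at hp1 hp2 hp3 hp4
      have h1 := hvA _ hp1
      have h2 := hvA _ hp2
      have h3 := hvA _ hp3
      have h4 := hvA _ hp4
      omega
  · have hvA : ∀ v ∈ support A, c.val ≤ v.val ∧ v.val ≤ d.val := by
      intro v hv
      obtain ⟨r, hr, hv⟩ := mem_support.1 hv
      have h1 := hA r hr
      have h2 := hend r (Finset.mem_filter.1 hr).1
      have h3 := next_cases r.1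
      have h4 := next_cases r.2
      simp only [ne_eq, Fin.ext_iff, mem_vert] at h2 hv
      omega
    have hvB : ∀ v ∈ support B, v.val ≤ c.val ∨ d.val < v.val ∨ v.val = (next c).val := by
      intro v hv
      obtain ⟨r, hr, hv⟩ := mem_support.1 hv
      have h1 := hB r hr
      have h2 := hend r (Finset.mem_filter.1 hr).1
      have h3 := next_cases r.1
      have h4 := next_cases r.2
      simp only [ne_eq, Fin.ext_iff, mem_vert] at h2 hv
      omega
    have hinter : (support A ∩ support B).card ≤ 2 := by
      refine (Finset.card_le_card (t := {c, next c}) fun v hv => ?_).trans Finset.card_le_two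
      have h1 := hvA v (Finset.mem_inter.1 hv).1
      have h2 := hvB v (Finset.mem_inter.1 hv).2
      simp only [Finset.mem_insert, Finset.mem_singleton, Fin.ext_iff]
      omega
    rcases hone hinter with h | h
    · rw [h, Finset.empty_union] at hp1 hp2 hp3 hp4
      have h1 := hvB _ hp1
      have h2 := hvB _ hp2
      have h3 := hvB _ hp3
      have h4 := hvB _ hp4
      omega
    · rw [h, Finset.union_empty] at hp1 hp3
      have h1 := hvA _ hp1
      have h3 := hvA _ hp3
      omega

/-- The diagram obtained by replacing an exact subdiagram by one of another diagram with the same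
support. -/
def swap (W W' : WilsonLoop n) {P P' : Finset (Fin n × Fin n)} (hP' : P' ⊆ W'.props) :
    WilsonLoop n where
  props := W.props \ P ∪ P'
  ordered p hp := by
    rcases Finset.mem_union.1 hp with h | h
    · exact W.ordered p (Finset.mem_sdiff.1 h).1
    · exact W'.ordered p (hP' h)

/-- For density, split `Q` along `P'`. The part in `P'` has surplus 3 by density of `W'`; density of
`W` applied to `P ∪ Q \ P'` shows that the rest brings at least as many vertices outside V(P) as it
has propagators. -/
theorem swap_weaklyAdmissible {W W' : WilsonLoop n} (hW : W.WeaklyAdmissible)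
    (hW' : W'.WeaklyAdmissible) {P P' : Finset (Fin n × Fin n)} (hP : W.IsExact P)
    (hP' : W'.IsExact P') (hsupp : support P = support P') :
    (swap W W' (P := P) hP'.1).WeaklyAdmissible where
  density Q hQ hne := by
    classical
    rcases (Q ∩ P').eq_empty_or_nonempty with h0 | h1
    · refine hW.density Q (fun q hq => ?_) hne
      rcases Finset.mem_union.1 (hQ hq) with h | h
      · exact (Finset.mem_sdiff.1 h).1
      · exact absurd (Finset.mem_inter.2 ⟨hq, h⟩) (by simp [h0])
    have hrest : Q \ P' ⊆ W.props \ P := by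
      intro q hq
      obtain ⟨hq, hqP'⟩ := Finset.mem_sdiff.1 hq
      exact (Finset.mem_union.1 (hQ hq)).resolve_right hqP'
    have h2 := hW'.density (Q ∩ P') (Finset.inter_subset_right.trans hP'.1) h1
    have h3 := hW.density (P ∪ Q \ P')
      (Finset.union_subset hP.1 (hrest.trans Finset.sdiff_subset))
      (hP.nonempty.mono Finset.subset_union_left)
    rw [Finset.card_union_of_disjoint (Finset.disjoint_sdiff.mono_right hrest), support_union,
      Finset.union_comm, ← Finset.card_sdiff_add_card, hP.2] at h3
    have h4 : Disjoint (support (Q \ P') \ support P) (support (Q ∩ P')) := by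
      refine Finset.sdiff_disjoint.mono_right ?_
      rw [hsupp]
      exact support_mono Finset.inter_subset_right
    have h5 := Finset.card_le_card (Finset.union_subset
      (Finset.sdiff_subset.trans (support_mono (Finset.sdiff_subset (s := Q) (t := P'))))
      (support_mono Finset.inter_subset_left) :
      support (Q \ P') \ support P ∪ support (Q ∩ P') ⊆ support Q)
    rw [Finset.card_union_of_disjoint h4] at h5
    have h6 := Finset.card_sdiff_add_card_inter Q P'
    omega
  noncrossing := by
    have hqP : ∀ q ∈ W.props \ P, ¬ vert q ⊆ support P := fun q hq hv =>
      (Finset.mem_sdiff.1 hq).2 (hP.mem_of_vert_subset hW (Finset.mem_sdiff.1 hq).1 hv)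
    have key : ∀ p ∈ P', ∀ q ∈ W.props \ P, ¬ Crosses p q ∧ ¬ Crosses q p := by
      intro p hp q hq
      have hqW := (Finset.mem_sdiff.1 hq).1
      exact hP.not_crosses hW (W.ordered q hqW)
        (fun r hr => ⟨fun h => hW.noncrossing ⟨r, hP.1 hr, q, hqW, h⟩,
          fun h => hW.noncrossing ⟨q, hqW, r, hP.1 hr, h⟩⟩)
        (hqP q hq) (hsupp ▸ vert_subset_support hp)
    rintro ⟨p, hp, q, hq, h⟩
    rcases Finset.mem_union.1 hp with hp | hp <;> rcases Finset.mem_union.1 hq with hq | hq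
    · exact hW.noncrossing ⟨p, (Finset.mem_sdiff.1 hp).1, q, (Finset.mem_sdiff.1 hq).1, h⟩
    · exact (key q hq p hp).2 h
    · exact (key p hp q hq).1 h
    · exact hW'.noncrossing ⟨p, hP'.1 hp, q, hP'.1 hq, h⟩

/-! ### Trivial exact subdiagrams -/

/-- A propagator with four supporting vertices is determined by them, unless `n = 4`. -/
theorem eq_of_vert_eq (hn : n ≠ 4) {p q : Fin n × Fin n} (hp : p.1 < p.2) (hq : q.1 < q.2)
    (h4 : (vert p).card = 4) (h : vert p = vert q) : p = q := by
  obtain ⟨a, b⟩ := p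
  obtain ⟨c, d⟩ := q
  have hab : a ≠ b ∧ next a ≠ b ∧ next b ≠ a := by
    refine ⟨?_, ?_, ?_⟩ <;> intro h0
    · exact hp.ne h0
    · have : (vert (a, b)).card ≤ 3 := by
        simpa [vert, h0] using Finset.card_le_three (a := a) (b := b) (c := next b)
      omega
    · have : (vert (a, b)).card ≤ 3 := by
        refine (Finset.card_le_card (t := {a, next a, b}) fun v hv => ?_).trans
          Finset.card_le_three
        simp only [mem_vert, h0] at hv
        simp only [Finset.mem_insert, Finset.mem_singleton]
        tauto
      omega
  have hc : c ∈ vert (a, b) := by simp [h, mem_vert]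
  have hc2 : next c ∈ vert (a, b) := by simp [h, mem_vert]
  have hd : d ∈ vert (a, b) := by simp [h, mem_vert]
  have hd2 : next d ∈ vert (a, b) := by simp [h, mem_vert]
  have ha : a ∈ vert (c, d) := by simp [← h, mem_vert]
  have hb : b ∈ vert (c, d) := by simp [← h, mem_vert]
  have ha2 : next a ∈ vert (c, d) := by simp [← h, mem_vert]
  have hb2 : next b ∈ vert (c, d) := by simp [← h, mem_vert]
  have h1 := next_cases a
  have h2 := next_cases b
  have h3 := next_cases c
  have h5 := next_cases d
  clear h h4
  simp only [mem_vert, Fin.ext_iff, Fin.lt_def, ne_eq, Prod.mk.injEq] at *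
  -- Besides the pairing into the edges at `a` and `b`, the vertices could only pair as `next a, b`
  -- and `next b, a`, which closes a cycle of length 4.
  have hc3 : c.val = (next a).val → (next c).val = b.val := by clear ha hb ha2 hb2 hd hd2; omega
  have hc4 : c.val = (next b).val → (next c).val = a.val := by clear ha hb ha2 hb2 hd hd2; omega
  have hd3 : d.val = (next a).val → (next d).val = b.val := by clear ha hb ha2 hb2 hc hc2; omega
  have hd4 : d.val = (next b).val → (next d).val = a.val := by clear ha hb ha2 hb2 hc hc2; omega
  clear hc2 hd2
  rcases hc with hc | hc | hc | hc <;> rcases hd with hd | hd | hd | hd <;>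
    rcases h1 with h1 | h1 <;> rcases h2 with h2 | h2 <;> omega

end WilsonLoop

/-! ### Exchange classes -/

namespace WeakWilsonLoop

open WilsonLoop

variable {n : ℕ}

theorem Exchange.matroid_eq {W W' : WeakWilsonLoop n} (h : Exchange W W') :
    W.1.matroid = W'.1.matroid := by
  obtain ⟨P, P', hP, hP', hcard, hsupp, hrest⟩ := h
  exact (matroid_eq_iff _ _).2 fun I =>
    ⟨Indep.of_exchange W'.2 hP' hcard hsupp hrest,
      Indep.of_exchange W.2 hP hcard.symm hsupp.symm hrest.symm⟩

theorem Equivalent.matroid_eq {W W' : WeakWilsonLoop n} (h : Equivalent W W') :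
    W.1.matroid = W'.1.matroid := by
  induction h with
  | refl => rfl
  | tail _ h ih => exact ih.trans h.matroid_eq

/-- Induction on the number of propagators of `W` outside `W'`: each swap removes at least one of
them and adds only propagators of `W'`. When none is left, equal rank gives equality. -/
theorem equivalent_of_matroid_eq (W W' : WeakWilsonLoop n) (h : W.1.matroid = W'.1.matroid) :
    Equivalent W W' := by
  classical
  induction hk : (W.1.props \ W'.1.props).card using Nat.strong_induction_on generalizing W with
  | _ k ih =>
  subst hk
  have hind := (matroid_eq_iff _ _).1 h
  rcases (W.1.props \ W'.1.props).eq_empty_or_nonempty with h0 | ⟨p, hp⟩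
  · have heq : W = W' := Subtype.ext (WilsonLoop.ext (Finset.eq_of_subset_of_card_le
      (Finset.sdiff_eq_empty_iff_subset.1 h0)
      (W'.2.card_le_of_indep_imp fun I => (hind I).2)))
    rw [heq]
    exact Relation.ReflTransGen.refl
  obtain ⟨hpW, hpW'⟩ := Finset.mem_sdiff.1 hp
  obtain ⟨P, P', hP, hP', hsupp, hpP⟩ := exists_common_exact W.2 W'.2 hind hpW
  let V : WeakWilsonLoop n := ⟨_, swap_weaklyAdmissible W.2 W'.2 hP hP' hsupp⟩
  have hVprops : V.1.props = W.1.props \ P ∪ P' := rfl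
  have hdisj : Disjoint (W.1.props \ P) P' := by
    rw [Finset.disjoint_left]
    intro q hq hqP'
    obtain ⟨hq, hqP⟩ := Finset.mem_sdiff.1 hq
    exact hqP (hP.mem_of_vert_subset W.2 hq (hsupp ▸ vert_subset_support hqP'))
  have hex : Exchange W V := by
    refine ⟨P, P', hP, ⟨Finset.subset_union_right, hP'.2⟩, ?_, hsupp, ?_⟩
    · have h1 := hP.2
      have h2 := hP'.2
      rw [hsupp] at h1
      omega
    · rw [hVprops, Finset.union_sdiff_cancel_right hdisj]
  refine Relation.ReflTransGen.head hex (ih _ ?_ V (hex.matroid_eq.symm.trans h) rfl)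
  refine Finset.card_lt_card (Finset.ssubset_iff_of_subset ?_ |>.2 ⟨p, hp, ?_⟩)
  · intro q hq
    rw [hVprops, Finset.mem_sdiff, Finset.mem_union, Finset.mem_sdiff] at hq
    exact Finset.mem_sdiff.2 ⟨(hq.1.resolve_right fun h => hq.2 (hP'.1 h)).1, hq.2⟩
  · rw [hVprops, Finset.mem_sdiff, Finset.mem_union, Finset.mem_sdiff]
    rintro ⟨⟨-, h⟩ | h, -⟩
    · exact h hpP
    · exact hpW' (hP'.1 h)

theorem eq_of_equivalent {W W' : WeakWilsonLoop n} (hW : ∀ V, Exchange W V → V = W)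
    (h : Equivalent W W') : W' = W := by
  induction h with
  | refl => rfl
  | tail _ h ih => exact hW _ (ih ▸ h)

theorem Exchange.eq_of_trivial (hn : n ≠ 4) {W W' : WeakWilsonLoop n}
    (hW : ¬ W.HasNontrivialExact) (h : Exchange W W') : W' = W := by
  obtain ⟨P, P', hP, hP', hcard, hsupp, hrest⟩ := h
  have h1 : P.card = 1 := by
    by_contra h1
    exact hW ⟨P, hP, h1⟩
  obtain ⟨p, rfl⟩ := Finset.card_eq_one.1 h1
  obtain ⟨q, rfl⟩ := Finset.card_eq_one.1 (hcard.symm.trans h1)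
  have hp := hP.1 (Finset.mem_singleton_self p)
  have hq := hP'.1 (Finset.mem_singleton_self q)
  have h4 := hP.2
  simp only [support, Finset.singleton_biUnion, Finset.card_singleton] at hsupp h4
  have hpq := eq_of_vert_eq hn (W.1.ordered p hp) (W'.1.ordered q hq) h4 hsupp
  subst hpq
  refine Subtype.ext (WilsonLoop.ext ?_)
  rw [← Finset.sdiff_union_of_subset hP.1, hrest, Finset.sdiff_union_of_subset hP'.1]

end WeakWilsonLoop

theorem theorem3p20 (n : ℕ) :
    (∀ W W' : WeakWilsonLoop n,
      W.1.matroid = W'.1.matroid ↔ WeakWilsonLoop.Equivalent W W') ∧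
    (∀ W : WeakWilsonLoop n,
      (∀ W' : WeakWilsonLoop n, W'.1.matroid = W.1.matroid → W' = W) ↔
        ∀ W' : WeakWilsonLoop n, WeakWilsonLoop.Exchange W W' → W' = W) ∧
    (n ≠ 4 → ∀ W : WeakWilsonLoop n, ¬ W.HasNontrivialExact →
      ∀ W' : WeakWilsonLoop n, W'.1.matroid = W.1.matroid → W' = W) := by
  have hmain : ∀ W : WeakWilsonLoop n, (∀ V, WeakWilsonLoop.Exchange W V → V = W) →
      ∀ W' : WeakWilsonLoop n, W'.1.matroid = W.1.matroid → W' = W := fun W hW W' h =>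
    WeakWilsonLoop.eq_of_equivalent hW (WeakWilsonLoop.equivalent_of_matroid_eq W W' h.symm)
  exact ⟨fun W W' => ⟨WeakWilsonLoop.equivalent_of_matroid_eq W W', fun h => h.matroid_eq⟩,
    fun W => ⟨fun h W' hex => h W' hex.matroid_eq.symm, hmain W⟩,
    fun hn W hW => hmain W fun _ h => h.eq_of_trivial hn hW⟩
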